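/- Let $n$ be a natural number and $\sigma>0$, and let $A$ be an $n\times n$ random symmetric real matrix whose entries $A_{ij}$ on and above the diagonal ($1\le i\le j\le n$) are independent, identically distributed Gaussian random variables $\mathcal N(0,\sigma^2)$. Then, for every $t>0$, $$\mathbb P\left\{\|A\|\le 4\sigma\sqrt n+2t\right\}\ \ge\ 1-2\exp\left(-\frac{t^2}{2\sigma^2}\right),$$ where $\|A\|$ denotes the operator norm of $A$ with respect to the Euclidean norm on $\mathbb R^n$. -/

import Mathlib

open MeasureTheory ProbabilityTheory

open scoped RealInnerProductSpace ENNReal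

/-! Exponentials of Rayleigh quotients are averaged over the unit ball, in place of a net argument.
For each fixed direction the quadratic form is subgaussian with proxy `2σ²`, so by Tonelli the
expected average of `exp (s q) + exp (-s q)` is at most `2 exp (s²σ²)`. If `‖A‖ > S`, then `|q| ≥
7S/9` on a ball of radius 1/4 near a top eigenvector, a fraction `4⁻ⁿ` of the volume. Markov's
inequality bounds the tail by `2·4ⁿ exp (s²σ² - 7sS/9)`, and it remains to optimise in `s`. -/

/-! ### Rayleigh quotients near a top eigenvector -/

/-- A symmetric operator on a nontrivial finite-dimensional real inner product space has a unit
eigenvector whose eigenvalue dominates the operator norm. -/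
theorem exists_unit_eigenvector_norm_le {E : Type*} [NormedAddCommGroup E] [InnerProductSpace ℝ E]
    [FiniteDimensional ℝ E] [Nontrivial E] (T : E →L[ℝ] E)
    (hT : (T : E →ₗ[ℝ] E).IsSymmetric) :
    ∃ (v : E) (μ : ℝ), ‖v‖ = 1 ∧ T v = μ • v ∧ ‖T‖ ≤ |μ| := by
  have hpos : 0 < Module.finrank ℝ E := Module.finrank_pos
  have : Nonempty (Fin (Module.finrank ℝ E)) := ⟨⟨0, hpos⟩⟩
  set b := hT.eigenvectorBasis rfl with hb
  set μ := hT.eigenvalues rfl with hμ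
  obtain ⟨k, hk⟩ := Finite.exists_max (fun i => |μ i|)
  have happ : ∀ i, T (b i) = μ i • b i := fun i => hT.apply_eigenvectorBasis rfl i
  refine ⟨b k, μ k, b.orthonormal.1 k, happ k, ?_⟩
  refine ContinuousLinearMap.opNorm_le_bound _ (abs_nonneg _) fun x => ?_
  refine le_of_sq_le_sq ?_ (by positivity)
  rw [mul_pow, ← b.sum_sq_norm_inner_right, ← b.sum_sq_norm_inner_right x, Finset.mul_sum]
  refine Finset.sum_le_sum fun i _ => ?_
  have : ⟪b i, T x⟫ = μ i * ⟪b i, x⟫ := by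
    have h := hT (b i) x
    simp only [ContinuousLinearMap.coe_coe] at h
    rw [← h, happ, real_inner_smul_left]
  rw [this, norm_mul, mul_pow, Real.norm_eq_abs (μ i)]
  have := hk i
  gcongr

/-- Near a dominating eigenvector the quadratic form of a symmetric operator is large. -/
theorem norm_mul_sq_le_abs_inner_of_mem_ball {E : Type*} [NormedAddCommGroup E]
    [InnerProductSpace ℝ E] (T : E →L[ℝ] E) (hT : (T : E →ₗ[ℝ] E).IsSymmetric)
    {v : E} {μ : ℝ} (hv : ‖v‖ = 1) (hTv : T v = μ • v) (hμ : ‖T‖ ≤ |μ|) {y : E}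
    (hy : y ∈ Metric.ball ((3 / 4 : ℝ) • v) (1 / 4)) :
    7 / 9 * ‖T‖ * ‖y‖ ^ 2 ≤ |⟪y, T y⟫| := by
  obtain ⟨p, hp⟩ : ∃ p, p = ⟪y, v⟫ := ⟨_, rfl⟩
  obtain ⟨w, hw⟩ : ∃ w, w = y - p • v := ⟨_, rfl⟩
  have hvv : ⟪v, v⟫ = 1 := by rw [real_inner_self_eq_norm_sq, hv]; norm_num
  have hyw : y = p • v + w := by rw [hw]; abel
  have hwv : ⟪w, v⟫ = 0 := by
    rw [hw, inner_sub_left, real_inner_smul_left, hvv, ← hp]; ring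
  have hvw : ⟪v, w⟫ = 0 := by rw [real_inner_comm, hwv]
  have hnorm : ‖y‖ ^ 2 = p ^ 2 + ‖w‖ ^ 2 := by
    rw [← real_inner_self_eq_norm_sq, ← real_inner_self_eq_norm_sq, hyw]
    simp only [inner_add_left, inner_add_right, real_inner_smul_left, real_inner_smul_right,
      hvv, hwv, hvw]
    ring
  have hvTw : ⟪v, T w⟫ = 0 := by
    have h := hT v w
    simp only [ContinuousLinearMap.coe_coe] at h
    rw [← h, hTv, real_inner_smul_left, hvw, mul_zero]
  have hquad : ⟪y, T y⟫ = p ^ 2 * μ + ⟪w, T w⟫ := by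
    rw [hyw]
    simp only [map_add, map_smul, hTv, inner_add_left, inner_add_right, real_inner_smul_left,
      real_inner_smul_right, hvv, hwv, hvTw]
    ring
  have hwT : |⟪w, T w⟫| ≤ ‖T‖ * ‖w‖ ^ 2 := by
    calc |⟪w, T w⟫| ≤ ‖w‖ * ‖T w‖ := abs_real_inner_le_norm _ _
      _ ≤ ‖w‖ * (‖T‖ * ‖w‖) := by gcongr; exact T.le_opNorm w
      _ = ‖T‖ * ‖w‖ ^ 2 := by ring
  have hlow : p ^ 2 * ‖T‖ - ‖T‖ * ‖w‖ ^ 2 ≤ |⟪y, T y⟫| := by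
    have h1 : |p ^ 2 * μ| - |⟪w, T w⟫| ≤ |p ^ 2 * μ + ⟪w, T w⟫| := by
      have h := abs_sub_abs_le_abs_sub (p ^ 2 * μ) (-⟪w, T w⟫)
      rwa [abs_neg, sub_neg_eq_add] at h
    have h2 : p ^ 2 * ‖T‖ ≤ |p ^ 2 * μ| := by
      rw [abs_mul, abs_of_nonneg (sq_nonneg p)]; gcongr
    rw [hquad]; linarith
  have hball : ‖y‖ ^ 2 + 1 / 2 ≤ 3 / 2 * p := by
    have h1 : ‖y - (3 / 4 : ℝ) • v‖ ^ 2 ≤ (1 / 4) ^ 2 := by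
      have := (mem_ball_iff_norm.1 hy).le
      gcongr
    rw [norm_sub_sq_real, real_inner_smul_right, norm_smul, hv, ← hp] at h1
    norm_num at h1
    linarith
  -- AM-GM: `(r + 1/2)² ≥ 2r` with `r = ‖y‖²`. The ball lies in the cone `sin θ ≤ 1/3` about `v`,
  -- whence `7/9 = 8/9 - 1/9`.
  have hcone : 8 / 9 * ‖y‖ ^ 2 ≤ p ^ 2 := by
    nlinarith [sq_nonneg (‖y‖ ^ 2 - 1 / 2), sq_nonneg ‖y‖]
  nlinarith [mul_le_mul_of_nonneg_left hcone (norm_nonneg T), norm_nonneg T]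

/-! ### Moment generating function of the quadratic form -/

/-- Only entries on and above the diagonal are independent, so the form is folded onto them. -/
theorem sum_sum_eq_sum_upper {ι : Type*} [Fintype ι] [LinearOrder ι] (f : ι → ι → ℝ) :
    ∑ i, ∑ j, f i j = ∑ p : {p : ι × ι // p.1 ≤ p.2},
      if p.1.1 = p.1.2 then f p.1.1 p.1.2 else f p.1.1 p.1.2 + f p.1.2 p.1.1 := by
  have hsub : (∑ p : {p : ι × ι // p.1 ≤ p.2},
      if p.1.1 = p.1.2 then f p.1.1 p.1.2 else f p.1.1 p.1.2 + f p.1.2 p.1.1)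
      = ∑ i, ∑ j, if i ≤ j then (if i = j then f i j else f i j + f j i) else 0 := by
    rw [← Fintype.sum_prod_type'
      (f := fun i j => if i ≤ j then (if i = j then f i j else f i j + f j i) else 0),
      ← Finset.sum_filter]
    exact (Finset.sum_subtype (Finset.univ.filter fun p : ι × ι => p.1 ≤ p.2) (by simp)
      (fun p => if p.1 = p.2 then f p.1 p.2 else f p.1 p.2 + f p.2 p.1)).symm
  have hlow : ∑ i, ∑ j, (if j < i then f i j else 0) = ∑ i, ∑ j, if i < j then f j i else 0 :=
    Finset.sum_comm
  have hsplit : ∑ i, ∑ j, f i j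
      = ∑ i, ∑ j, (if i ≤ j then f i j else 0) + ∑ i, ∑ j, (if j < i then f i j else 0) := by
    simp only [← Finset.sum_add_distrib]
    refine Finset.sum_congr rfl fun i _ => Finset.sum_congr rfl fun j _ => ?_
    rcases le_or_gt i j with h | h
    · simp [h, not_lt.2 h]
    · simp [h, not_le.2 h]
  rw [hsub, hsplit, hlow]
  simp only [← Finset.sum_add_distrib]
  refine Finset.sum_congr rfl fun i _ => Finset.sum_congr rfl fun j _ => ?_
  rcases lt_trichotomy i j with h | h | h
  · simp [h, h.le, h.ne]
  · simp [h]
  · simp [not_le.2 h, not_lt.2 h.le]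

theorem hasSubgaussianMGF_of_hasLaw_gaussianReal {Ω : Type*} [MeasurableSpace Ω] {P : Measure Ω}
    {X : Ω → ℝ} {v : NNReal} (h : HasLaw X (gaussianReal 0 v) P) : HasSubgaussianMGF X v P where
  integrable_exp_mul s := by
    have h1 := integrable_exp_mul_gaussianReal (μ := 0) (v := v) s
    rw [← h.map_eq] at h1
    exact h1.comp_aemeasurable h.aemeasurable
  mgf_le s := by
    rw [mgf_gaussianReal h.map_eq]; simp

/-- A unit-scale quadratic form of a symmetric Gaussian matrix has Gaussian moment generating
function with variance proxy `2σ²`. -/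
theorem lintegral_exp_quadratic_le {Ω : Type*} [MeasurableSpace Ω] {P : Measure Ω}
    {n : ℕ} {σ : ℝ} {A : Ω → Matrix (Fin n) (Fin n) ℝ}
    (hsymm : ∀ᵐ ω ∂P, (A ω).IsSymm)
    (hlaw : ∀ i j : Fin n, i ≤ j →
      HasLaw (fun ω => A ω i j) (gaussianReal 0 (Real.toNNReal (σ ^ 2))) P)
    (hindep : iIndepFun
      (fun (p : {p : Fin n × Fin n // p.1 ≤ p.2}) (ω : Ω) => A ω p.1.1 p.1.2) P)
    (u : Fin n → ℝ) (hu : ∑ i, u i ^ 2 ≤ 1) (s : ℝ) :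
    ∫⁻ ω, ENNReal.ofReal (Real.exp (s * ∑ i, ∑ j, A ω i j * (u i * u j))) ∂P
      ≤ ENNReal.ofReal (Real.exp (s ^ 2 * σ ^ 2)) := by
  set c : {p : Fin n × Fin n // p.1 ≤ p.2} → ℝ := fun p =>
    if p.1.1 = p.1.2 then u p.1.1 * u p.1.2 else 2 * (u p.1.1 * u p.1.2) with hc
  have hsub := HasSubgaussianMGF.sum_of_iIndepFun
    (hindep.comp (fun p x => c p * x) (fun p => measurable_const_mul (c p)))
    (s := Finset.univ) (fun p _ =>
      (hasSubgaussianMGF_of_hasLaw_gaussianReal (hlaw p.1.1 p.1.2 p.2)).const_mul (c p))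
  have hae : ∀ᵐ ω ∂P, ∑ i, ∑ j, A ω i j * (u i * u j)
      = ∑ p : {p : Fin n × Fin n // p.1 ≤ p.2}, c p * A ω p.1.1 p.1.2 := by
    filter_upwards [hsymm] with ω hω
    rw [sum_sum_eq_sum_upper]
    refine Finset.sum_congr rfl fun p _ => ?_
    rw [hω.apply p.1.1 p.1.2]
    simp only [hc]
    split_ifs <;> ring
  -- Off the diagonal `(2 uᵢuⱼ)²` equals the two mirrored terms `2 uᵢ²uⱼ²`; on the diagonal there is
  -- a factor 2 to spare.
  have hcsq : ∑ p, c p ^ 2 ≤ 2 := by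
    calc ∑ p, c p ^ 2 ≤ ∑ i, ∑ j, 2 * (u i ^ 2 * u j ^ 2) := by
          rw [sum_sum_eq_sum_upper]
          refine Finset.sum_le_sum fun p _ => ?_
          simp only [hc]
          split_ifs
          · nlinarith [sq_nonneg (u p.1.1 * u p.1.2)]
          · exact le_of_eq (by ring)
      _ = 2 * ((∑ i, u i ^ 2) * ∑ j, u j ^ 2) := by
          rw [Finset.sum_mul_sum]; simp only [Finset.mul_sum]
      _ ≤ 2 := by nlinarith [Finset.sum_nonneg fun i (_ : i ∈ Finset.univ) => sq_nonneg (u i)]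
  have hint := hsub.integrable_exp_mul s
  have hle := hsub.mgf_le s
  have hlint := ofReal_integral_eq_lintegral_ofReal hint
    (ae_of_all _ fun ω => (Real.exp_pos _).le)
  refine (lintegral_mono_ae ?_).trans
    (hlint.symm.le.trans (ENNReal.ofReal_le_ofReal (hle.trans (Real.exp_le_exp.2 ?_))))
  · filter_upwards [hae] with ω hω
    rw [hω]
    exact le_rfl
  have hcoe : ((∑ p, NNReal.mk (c p ^ 2) (sq_nonneg _) * Real.toNNReal (σ ^ 2) : NNReal) : ℝ)
      = (∑ p, c p ^ 2) * σ ^ 2 := by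
    rw [NNReal.coe_sum, Finset.sum_mul]
    refine Finset.sum_congr rfl fun p _ => ?_
    rw [NNReal.coe_mul, Real.coe_toNNReal _ (sq_nonneg σ), NNReal.coe_mk]
  refine (congrArg (fun r : ℝ => r * s ^ 2 / 2) hcoe).le.trans ?_
  have : 0 ≤ σ ^ 2 * s ^ 2 := by positivity
  nlinarith [mul_le_mul_of_nonneg_right hcsq this]

/-! ### Averaging over the unit ball -/

theorem aemeasurable_entry_of_symm {Ω : Type*} [MeasurableSpace Ω] {P : Measure Ω}
    {n : ℕ} {A : Ω → Matrix (Fin n) (Fin n) ℝ} (hsymm : ∀ᵐ ω ∂P, (A ω).IsSymm)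
    (hA : ∀ i j : Fin n, i ≤ j → AEMeasurable (fun ω => A ω i j) P) (i j : Fin n) :
    AEMeasurable (fun ω => A ω i j) P := by
  rcases le_total i j with h | h
  · exact hA i j h
  · refine (hA j i h).congr ?_
    filter_upwards [hsymm] with ω hω
    exact hω.apply i j

theorem sum_sum_eq_inner_toEuclideanCLM {n : ℕ} (M : Matrix (Fin n) (Fin n) ℝ)
    (y : EuclideanSpace ℝ (Fin n)) :
    ∑ i, ∑ j, M i j * (y i * y j) = ⟪y, Matrix.toEuclideanCLM (n := Fin n) (𝕜 := ℝ) M y⟫ := by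
  rw [Matrix.inner_toEuclideanCLM]
  simp only [dotProduct, Matrix.mulVec, Finset.mul_sum]
  refine Finset.sum_congr rfl fun i _ => Finset.sum_congr rfl fun j _ => by ring

/-- Exponential tail bound for the operator norm of a symmetric random matrix with Gaussian
entries, obtained by averaging exponentials of Rayleigh quotients over the unit ball. -/
theorem measure_norm_gt_le {Ω : Type*} [MeasurableSpace Ω] (P : Measure Ω) [SFinite P]
    (n : ℕ) (σ : ℝ) (A : Ω → Matrix (Fin n) (Fin n) ℝ)
    (hsymm : ∀ᵐ ω ∂P, (A ω).IsSymm)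
    (hlaw : ∀ i j : Fin n, i ≤ j →
      HasLaw (fun ω => A ω i j) (gaussianReal 0 (Real.toNNReal (σ ^ 2))) P)
    (hindep : iIndepFun
      (fun (p : {p : Fin n × Fin n // p.1 ≤ p.2}) (ω : Ω) => A ω p.1.1 p.1.2) P)
    {S s : ℝ} (hS : 0 ≤ S) (hs : 0 ≤ s) :
    P {ω | S < ‖Matrix.toEuclideanCLM (n := Fin n) (𝕜 := ℝ) (A ω)‖}
      ≤ ENNReal.ofReal (2 * 4 ^ n * Real.exp (s ^ 2 * σ ^ 2 - s * (7 / 9 * S))) := by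
  set T : Ω → EuclideanSpace ℝ (Fin n) →L[ℝ] EuclideanSpace ℝ (Fin n) :=
    fun ω => Matrix.toEuclideanCLM (n := Fin n) (𝕜 := ℝ) (A ω) with hTdef
  -- At `y = 0` the inverse norm is 0, so the direction vector has norm at most 1, not always 1.
  set q : Ω → EuclideanSpace ℝ (Fin n) → ℝ := fun ω y =>
    ∑ i, ∑ j, A ω i j * ((‖y‖⁻¹ • y) i * (‖y‖⁻¹ • y) j) with hq
  set ν : Measure (EuclideanSpace ℝ (Fin n)) := volume.restrict (Metric.ball 0 1) with hν
  set V : ℝ≥0∞ := volume (Metric.ball (0 : EuclideanSpace ℝ (Fin n)) 1) with hV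
  have hV0 : V ≠ 0 := (Metric.measure_ball_pos volume _ one_pos).ne'
  have hVtop : V ≠ ∞ := measure_ball_lt_top.ne
  -- Both signs are needed: the dominating eigenvalue may be negative.
  set g : Ω → EuclideanSpace ℝ (Fin n) → ℝ≥0∞ := fun ω y =>
    ENNReal.ofReal (Real.exp (s * q ω y)) + ENNReal.ofReal (Real.exp (-s * q ω y)) with hg
  have hAm := aemeasurable_entry_of_symm hsymm fun i j h => (hlaw i j h).aemeasurable
  have hqm : AEMeasurable (Function.uncurry q) (P.prod ν) := by
    simp only [hq, Function.uncurry_def]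
    refine Finset.aemeasurable_fun_sum _ fun i _ => Finset.aemeasurable_fun_sum _ fun j _ => ?_
    refine ((hAm i j).comp_fst (ν := ν)).mul (Measurable.aemeasurable ?_)
    simp only [PiLp.smul_apply]
    fun_prop
  have hem : ∀ r : ℝ, AEMeasurable
      (fun z : Ω × EuclideanSpace ℝ (Fin n) => ENNReal.ofReal (Real.exp (r * q z.1 z.2)))
      (P.prod ν) := fun r =>
    (Real.measurable_exp.comp_aemeasurable (hqm.const_mul r)).ennreal_ofReal
  have hgm : AEMeasurable (Function.uncurry g) (P.prod ν) := (hem s).add (hem (-s))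
  have hnorm : ∀ y : EuclideanSpace ℝ (Fin n), ∑ i, (‖y‖⁻¹ • y) i ^ 2 ≤ 1 := by
    intro y
    rw [← EuclideanSpace.real_norm_sq_eq, norm_smul, norm_inv, norm_norm]
    rcases eq_or_ne ‖y‖ 0 with h | h
    · simp [h]
    · simp [inv_mul_cancel₀ h]
  have hupper : ∫⁻ ω, ∫⁻ y, g ω y ∂ν ∂P
      ≤ ENNReal.ofReal (2 * Real.exp (s ^ 2 * σ ^ 2)) * V := by
    rw [lintegral_lintegral_swap hgm]
    have hpt : ∀ y, ∫⁻ ω, g ω y ∂P ≤ ENNReal.ofReal (2 * Real.exp (s ^ 2 * σ ^ 2)) := by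
      intro y
      have hm : AEMeasurable (fun ω => ENNReal.ofReal (Real.exp (s * q ω y))) P := by
        refine (Real.measurable_exp.comp_aemeasurable (AEMeasurable.const_mul ?_ s)).ennreal_ofReal
        refine Finset.aemeasurable_fun_sum _ fun i _ => Finset.aemeasurable_fun_sum _ fun j _ => ?_
        exact (hAm i j).mul_const _
      simp only [hg]
      rw [lintegral_add_left' hm, two_mul, ENNReal.ofReal_add (by positivity) (by positivity)]
      refine add_le_add (lintegral_exp_quadratic_le hsymm hlaw hindep _ (hnorm y) s) ?_
      have h := lintegral_exp_quadratic_le hsymm hlaw hindep _ (hnorm y) (-s)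
      rwa [neg_sq] at h
    refine (lintegral_mono hpt).trans ?_
    rw [lintegral_const, hν, Measure.restrict_apply_univ]
  have hlower : ∀ ω, (A ω).IsSymm → S < ‖T ω‖ →
      ENNReal.ofReal ((1 / 4) ^ n * Real.exp (s * (7 / 9 * S))) * V ≤ ∫⁻ y, g ω y ∂ν := by
    intro ω hω hn
    have : Nontrivial (EuclideanSpace ℝ (Fin n)) := by
      by_contra h
      rw [not_nontrivial_iff_subsingleton] at h
      have : T ω = 0 := Subsingleton.elim _ _
      rw [this, norm_zero] at hn
      linarith
    have hTs : (T ω : EuclideanSpace ℝ (Fin n) →ₗ[ℝ] EuclideanSpace ℝ (Fin n)).IsSymmetric := by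
      rw [hTdef, Matrix.coe_toEuclideanCLM_eq_toEuclideanLin]
      refine Matrix.isSymmetric_toEuclideanLin_iff.2 ?_
      rwa [Matrix.IsHermitian, Matrix.conjTranspose_eq_transpose_of_trivial]
    obtain ⟨v, μ, hv, hTv, hμ⟩ := exists_unit_eigenvector_norm_le (T ω) hTs
    have hsubset : Metric.ball ((3 / 4 : ℝ) • v) (1 / 4) ⊆ Metric.ball 0 1 := by
      refine Metric.ball_subset_ball' ?_
      rw [dist_zero_right, norm_smul, hv]
      norm_num
    have hlow : ∀ y ∈ Metric.ball ((3 / 4 : ℝ) • v) (1 / 4),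
        ENNReal.ofReal (Real.exp (s * (7 / 9 * S))) ≤ g ω y := by
      intro y hy
      have hy0 : 0 < ‖y‖ := by
        rw [norm_pos_iff]
        rintro rfl
        rw [mem_ball_iff_norm, zero_sub, norm_neg, norm_smul, hv] at hy
        norm_num at hy
      have hqy : q ω y = ⟪y, T ω y⟫ / ‖y‖ ^ 2 := by
        simp only [hq]
        rw [sum_sum_eq_inner_toEuclideanCLM, map_smul, real_inner_smul_left, real_inner_smul_right]
        field_simp
        rfl
      have habs : 7 / 9 * S ≤ |q ω y| := by
        rw [hqy, abs_div, abs_of_pos (by positivity : 0 < ‖y‖ ^ 2), le_div_iff₀ (by positivity)]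
        refine le_trans ?_ (norm_mul_sq_le_abs_inner_of_mem_ball (T ω) hTs hv hTv hμ hy)
        gcongr
      rcases le_abs'.1 habs with h | h
      · refine le_trans (ENNReal.ofReal_le_ofReal (Real.exp_le_exp.2 ?_)) le_add_self
        nlinarith
      · refine le_trans (ENNReal.ofReal_le_ofReal (Real.exp_le_exp.2 ?_)) le_self_add
        gcongr
    calc ENNReal.ofReal ((1 / 4) ^ n * Real.exp (s * (7 / 9 * S))) * V
        = ENNReal.ofReal (Real.exp (s * (7 / 9 * S)))
          * volume (Metric.ball ((3 / 4 : ℝ) • v) (1 / 4)) := by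
          rw [Measure.addHaar_ball _ _ (by norm_num), finrank_euclideanSpace_fin,
            ENNReal.ofReal_mul (by positivity)]
          ring
      _ = ∫⁻ _ in Metric.ball ((3 / 4 : ℝ) • v) (1 / 4),
            ENNReal.ofReal (Real.exp (s * (7 / 9 * S))) := (setLIntegral_const _ _).symm
      _ ≤ ∫⁻ y in Metric.ball ((3 / 4 : ℝ) • v) (1 / 4), g ω y :=
          setLIntegral_mono' measurableSet_ball hlow
      _ ≤ ∫⁻ y, g ω y ∂ν := lintegral_mono_set hsubset
  set a : ℝ := (1 / 4) ^ n * Real.exp (s * (7 / 9 * S)) with ha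
  have ha0 : 0 < a := by positivity
  have hmarkov := (mul_meas_ge_le_lintegral₀ hgm.lintegral_prod_right'
    (ENNReal.ofReal a * V)).trans hupper
  have hmono : P {ω | S < ‖T ω‖} ≤ P {ω | ENNReal.ofReal a * V ≤ ∫⁻ y, g ω y ∂ν} :=
    measure_mono_ae (by filter_upwards [hsymm] with ω hω h using hlower ω hω h)
  have hfin : ENNReal.ofReal a * P {ω | S < ‖T ω‖}
      ≤ ENNReal.ofReal (2 * Real.exp (s ^ 2 * σ ^ 2)) := by
    rw [← ENNReal.mul_le_mul_iff_left hV0 hVtop]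
    refine le_trans ?_ hmarkov
    rw [mul_right_comm]
    exact mul_le_mul_right hmono _
  have heq : 2 * 4 ^ n * Real.exp (s ^ 2 * σ ^ 2 - s * (7 / 9 * S))
      = 2 * Real.exp (s ^ 2 * σ ^ 2) / a := by
    rw [ha, Real.exp_sub, one_div, inv_pow]
    field_simp
  rw [heq, ENNReal.ofReal_div_of_pos ha0, ENNReal.le_div_iff_mul_le (by simp [ha0]) (by simp),
    mul_comm]
  exact hfin

/-! ### Choice of parameters -/

theorem mainTheorem6 {Ω : Type*} [MeasurableSpace Ω] (P : Measure Ω) [IsProbabilityMeasure P]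
    (n : ℕ) (σ : ℝ) (hσ : 0 < σ)
    (A : Ω → Matrix (Fin n) (Fin n) ℝ)
    (hsymm : ∀ᵐ ω ∂P, (A ω).IsSymm)
    (hlaw : ∀ i j : Fin n, i ≤ j →
      HasLaw (fun ω => A ω i j) (gaussianReal 0 (Real.toNNReal (σ ^ 2))) P)
    (hindep : iIndepFun
      (fun (p : {p : Fin n × Fin n // p.1 ≤ p.2}) (ω : Ω) => A ω p.1.1 p.1.2) P)
    (t : ℝ) (ht : 0 < t) :
    1 - 2 * Real.exp (-(t ^ 2 / (2 * σ ^ 2))) ≤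
      P.real {ω | ‖Matrix.toEuclideanCLM (n := Fin n) (𝕜 := ℝ) (A ω)‖
        ≤ 4 * σ * Real.sqrt (n : ℝ) + 2 * t} := by
  obtain ⟨S, hSdef⟩ : ∃ S, S = 4 * σ * Real.sqrt (n : ℝ) + 2 * t := ⟨_, rfl⟩
  have hS : 0 ≤ S := by rw [hSdef]; positivity
  -- This `s` minimises `s²σ² - 7sS/9`, with value `-49S²/(324σ²)`.
  have htail := measure_norm_gt_le P n σ A hsymm hlaw hindep hS
    (s := 7 * S / (18 * σ ^ 2)) (by positivity)
  have hcompl : {ω | ‖Matrix.toEuclideanCLM (n := Fin n) (𝕜 := ℝ) (A ω)‖ ≤ S}ᶜ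
      = {ω | S < ‖Matrix.toEuclideanCLM (n := Fin n) (𝕜 := ℝ) (A ω)‖} := by
    ext ω; simp
  have hreal : P.real {ω | S < ‖Matrix.toEuclideanCLM (n := Fin n) (𝕜 := ℝ) (A ω)‖}
      ≤ 2 * 4 ^ n * Real.exp ((7 * S / (18 * σ ^ 2)) ^ 2 * σ ^ 2
        - 7 * S / (18 * σ ^ 2) * (7 / 9 * S)) :=
    ENNReal.toReal_le_of_le_ofReal (by positivity) htail
  have hone : 1 ≤ P.real {ω | ‖Matrix.toEuclideanCLM (n := Fin n) (𝕜 := ℝ) (A ω)‖ ≤ S}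
      + P.real {ω | S < ‖Matrix.toEuclideanCLM (n := Fin n) (𝕜 := ℝ) (A ω)‖} := by
    rw [← hcompl]
    calc (1 : ℝ) = P.real ({ω | ‖Matrix.toEuclideanCLM (n := Fin n) (𝕜 := ℝ) (A ω)‖ ≤ S}
          ∪ {ω | ‖Matrix.toEuclideanCLM (n := Fin n) (𝕜 := ℝ) (A ω)‖ ≤ S}ᶜ) := by
          rw [Set.union_compl_self, probReal_univ]
      _ ≤ _ := measureReal_union_le _ _
  have hfour : (4 : ℝ) ^ n ≤ Real.exp (2 * n) := by
    rw [mul_comm, Real.exp_nat_mul]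
    refine pow_le_pow_left₀ (by norm_num) ?_ n
    have h := Real.add_one_le_exp (1 : ℝ)
    have h2 : Real.exp 2 = Real.exp 1 ^ 2 := by rw [← Real.exp_nat_mul]; norm_num
    rw [h2]
    nlinarith
  have hexp : 2 * 4 ^ n * Real.exp ((7 * S / (18 * σ ^ 2)) ^ 2 * σ ^ 2
      - 7 * S / (18 * σ ^ 2) * (7 / 9 * S)) ≤ 2 * Real.exp (-(t ^ 2 / (2 * σ ^ 2))) := by
    rw [mul_assoc]
    refine mul_le_mul_of_nonneg_left ?_ (by norm_num)
    refine (mul_le_mul_of_nonneg_right hfour (Real.exp_pos _).le).trans ?_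
    rw [← Real.exp_add, Real.exp_le_exp]
    have hσ2 : 0 < σ ^ 2 := by positivity
    have hSsq : 16 * σ ^ 2 * n + 4 * t ^ 2 ≤ S ^ 2 := by
      have h1 : Real.sqrt (n : ℝ) ^ 2 = n := Real.sq_sqrt (Nat.cast_nonneg n)
      have h2 : 0 ≤ σ * Real.sqrt (n : ℝ) * t := by positivity
      rw [hSdef]
      nlinarith
    have h1 : (7 * S / (18 * σ ^ 2)) ^ 2 * σ ^ 2 - 7 * S / (18 * σ ^ 2) * (7 / 9 * S)
        = -(49 / 324 * S ^ 2 / σ ^ 2) := by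
      field_simp
      ring
    -- Suffices since `16·49/324 > 2` and `4·49/324 > 1/2`.
    have h2 : 2 * (n : ℝ) + t ^ 2 / (2 * σ ^ 2) ≤ 49 / 324 * S ^ 2 / σ ^ 2 := by
      rw [le_div_iff₀ hσ2, add_mul, div_mul_eq_mul_div, mul_comm 2 (σ ^ 2), ← div_div,
        mul_div_cancel_right₀ _ hσ2.ne']
      nlinarith [sq_nonneg t, mul_nonneg hσ2.le (Nat.cast_nonneg (α := ℝ) n)]
    linarith
  rw [← hSdef]
  linarith
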